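/- Let $(W_e)_{e\in\mathbb N}$ be the standard enumeration of the computably enumerable subsets of $\mathbb N$. For a finite sequence $\mathbf e=\langle e_1,\dots,e_n\rangle$ of indices let $W_{\mathbf e}=(W_{e_1}\smallsetminus W_{e_2})\cup(W_{e_3}\smallsetminus W_{e_4})\cup\cdots$, the last term being $W_{e_{n-1}}\smallsetminus W_{e_n}$ if $n$ is even and $W_{e_n}$ if $n$ is odd (and $W_{\langle\rangle}=\emptyset$); these are the $n$-c.e. sets. Let $h:\mathbb N\to\mathbb N^{<\omega}$ be any computable bijection, and let $=^{<\omega\text{-}ce}$ be the equivalence relation on $\mathbb N$ under which $i$ and $j$ are equivalent if and only if $W_{h(i)}=W_{h(j)}$. Let $E_3^{ce}$ be the equivalence relation on $\mathbb N$ given by $e\mathrel{E_3^{ce}}e'$ if and only if, regarding $W_e$ and $W_{e'}$ as subsets of $\mathbb N\times\mathbb N$ via a computable pairing function, for every $n$ the $n$-th columns $\{m:\langle n,m\rangle\in W_e\}$ and $\{m:\langle n,m\rangle\in W_{e'}\}$ have finite symmetric difference. For relations $E,F$ on $\mathbb N$, say that $E$ is computably reducible to $F$ if there is a computable $f:\mathbb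 N\to\mathbb N$ such that $n\mathrel{E}n'\iff f(n)\mathrel{F}f(n')$ for all $n,n'$. Theorem. The relation $=^{<\omega\text{-}ce}$ is computably reducible to $E_3^{ce}$, but $E_3^{ce}$ is not computably reducible to $=^{<\omega\text{-}ce}$. Moreover, $=^{<\omega\text{-}ce}$ is $\Pi^0_2$, while $E_3^{ce}$ is $\Pi^0_4$-complete (with respect to many-one reducibility). -/

import Mathlib

/-- The `e`-th computably enumerable set `W_e`: the domain of the `e`-th partial computable
function, in Mathlib's standard numbering of programs. -/
def ceSet (e : ℕ) : Set ℕ :=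
  {x | ((Denumerable.ofNat Nat.Partrec.Code e).eval x).Dom}

/-- The `n`-c.e. set `(W_{e₁} ∖ W_{e₂}) ∪ (W_{e₃} ∖ W_{e₄}) ∪ ⋯` given by a sequence of indices
of length `n`; an unpaired last index contributes `∪ W_{eₙ}`. -/
def nceSet : List ℕ → Set ℕ
  | [] => ∅
  | [e] => ceSet e
  | e :: e' :: l => (ceSet e \ ceSet e') ∪ nceSet l

/-- The relation `=^{<ω-ce}` on `ℕ`, relative to a coding `h : ℕ → List ℕ` of finite sequences. -/
def EqNce (h : ℕ → List ℕ) (i j : ℕ) : Prop :=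
  nceSet (h i) = nceSet (h j)

/-- `E₀`: equality of sets of natural numbers up to a finite symmetric difference. -/
def E0 (A B : Set ℕ) : Prop :=
  (symmDiff A B).Finite

/-- `E₃` on sequences of sets of natural numbers: termwise `E₀`. -/
def E3 (A B : ℕ → Set ℕ) : Prop :=
  ∀ n, E0 (A n) (B n)

/-- The `n`-th column of a set, regarded as a subset of `ℕ × ℕ` through the pairing function. -/
def column (A : Set ℕ) (n : ℕ) : Set ℕ :=
  {m | Nat.pair n m ∈ A}

/-- `E₃^{ce}`: the relation `E₃` between the sequences of columns of `W_e` and `W_{e'}`. -/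
def E3ce (e e' : ℕ) : Prop :=
  E3 (column (ceSet e)) (column (ceSet e'))

/-- Computable reducibility `E ≤ F` of relations on `ℕ`. -/
def ComputablyReducible (E F : ℕ → ℕ → Prop) : Prop :=
  ∃ f : ℕ → ℕ, Computable f ∧ ∀ n n', E n n' ↔ F (f n) (f n')

mutual

/-- `Σ⁰ₙ` predicates of the arithmetical hierarchy (`Σ⁰₀ = Π⁰₀` are the computable ones). -/
def IsSigma0 : ℕ → ∀ {α : Type} [Primcodable α], (α → Prop) → Prop
  | 0, _, _, p => ComputablePred p
  | n + 1, α, _, p => ∃ q : α × ℕ → Prop, IsPi0 n q ∧ ∀ x, p x ↔ ∃ y, q (x, y)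

/-- `Π⁰ₙ` predicates of the arithmetical hierarchy (`Σ⁰₀ = Π⁰₀` are the computable ones). -/
def IsPi0 : ℕ → ∀ {α : Type} [Primcodable α], (α → Prop) → Prop
  | 0, _, _, p => ComputablePred p
  | n + 1, α, _, p => ∃ q : α × ℕ → Prop, IsSigma0 n q ∧ ∀ x, p x ↔ ∀ y, q (x, y)

end

/-- A predicate is `Π⁰ₙ`-complete if it is `Π⁰ₙ` and every `Π⁰ₙ` set of natural numbers is
many-one reducible to it. -/
def IsPi0Complete (n : ℕ) {α : Type} [Primcodable α] (p : α → Prop) : Prop :=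
  IsPi0 n p ∧ ∀ q : ℕ → Prop, IsPi0 n q → q ≤₀ p

-- Membership in an n-c.e. set is the limit of a computable 0-1 approximation that eventually stops
-- changing. Two such limits agree iff the approximations agree at infinitely many stages
-- (`iff_iff_forall_exists_eq`), so equality is `Π⁰₂`. For the reduction, column `x` collects all
-- `m` for which `x` looks like a member at some stage `≥ m`: it is all of `ℕ` if `x` is a member
-- and finite otherwise.
--
-- For `Π⁰₄`-hardness of `E3ce`, compare each column with `ℕ`, so that `E0` becomes cofiniteness. A
-- deficiency set is cofinite iff its sequence repeats some value `k` infinitely often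
-- (`finite_compl_deficiency_iff`), and `markerValue` arranges this to happen exactly when the
-- `k`-th of given c.e. sets is `ℕ`, which expresses any `∃ k, ∀ y, ∃ z` matrix. A reduction of
-- `E3ce` to a `Π⁰₂` relation would then make every `Π⁰₄` set `Π⁰₂`, which a diagonal set refutes.

open Filter

-- Stage approximations and indices of c.e. sets

/-- The stage `s` approximation of the computably enumerable set `W_e`. -/
def ceStage (s e x : ℕ) : Bool :=
  (Nat.Partrec.Code.evaln s (Denumerable.ofNat Nat.Partrec.Code e) x).isSome

theorem Primrec.ceStage {α : Type*} [Primcodable α] {s e x : α → ℕ} (hs : Primrec s)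
    (he : Primrec e) (hx : Primrec x) : Primrec fun a => ceStage (s a) (e a) (x a) :=
  Primrec.option_isSome.comp <| Nat.Partrec.Code.primrec_evaln.comp <|
    (hs.pair ((Primrec.ofNat Nat.Partrec.Code).comp he)).pair hx

theorem ceStage_mono {s t e x : ℕ} (hst : s ≤ t) (hs : ceStage s e x = true) :
    ceStage t e x = true := by
  obtain ⟨a, ha⟩ := Option.isSome_iff_exists.1 hs
  exact Option.isSome_iff_exists.2 ⟨a, Nat.Partrec.Code.evaln_mono hst ha⟩

theorem mem_ceSet_iff {e x : ℕ} : x ∈ ceSet e ↔ ∃ s, ceStage s e x = true := by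
  simp only [ceSet, Set.mem_ofPred_eq, Part.dom_iff_mem, Nat.Partrec.Code.evaln_complete, ceStage,
    Option.isSome_iff_exists, Option.mem_def]
  exact exists_comm

theorem eventually_ceStage (e x : ℕ) : ∀ᶠ s in atTop, (ceStage s e x = true ↔ x ∈ ceSet e) := by
  by_cases hx : x ∈ ceSet e
  · obtain ⟨s, hs⟩ := mem_ceSet_iff.1 hx
    filter_upwards [eventually_ge_atTop s] with t ht
    exact iff_of_true (ceStage_mono ht hs) hx
  · exact Eventually.of_forall fun s => iff_of_false (fun hs => hx (mem_ceSet_iff.2 ⟨s, hs⟩)) hx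

theorem REPred.exists_computable {α : Type*} [Primcodable α] {g : α × ℕ → Bool}
    (hg : Computable g) : REPred fun a => ∃ y, g (a, y) = true := by
  have hp : Partrec₂ fun a => ((fun y => g (a, y) : ℕ → Bool) : ℕ →. Bool) := hg
  refine (Partrec.rfind hp).dom_re.of_eq fun a => Nat.rfind_dom.trans ?_
  simp

/-- A uniformly computably enumerable sequence of sets has a computable sequence of indices. -/
theorem REPred.exists_index {α : Type*} [Primcodable α] {p : α × ℕ → Prop} (hp : REPred p) :
    ∃ f : α → ℕ, Computable f ∧ ∀ a x, x ∈ ceSet (f a) ↔ p (a, x) := by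
  obtain ⟨c, hc⟩ := Nat.Partrec.Code.exists_code.1 hp
  obtain ⟨curry, hcurry, heval⟩ := Nat.Partrec.Code.smn
  refine ⟨fun a => Encodable.encode (curry c (Encodable.encode a)),
    Computable.encode.comp (hcurry.comp (Computable.const c) Computable.encode), fun a x => ?_⟩
  simp [ceSet, heval, hc, Part.assert, Part.bind, Part.map]

-- Approximations of n-c.e. sets

/-- One step of the right-to-left evaluation of `nceSet` at a point: the state records membership
in `nceSet l`, in the first set of `l`, and in `nceSet l.tail`. -/
def nceStep (b : Bool) (r : Bool × Bool × Bool) : Bool × Bool × Bool :=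
  ((b && !r.2.1) || r.2.2, b, r.1)

/-- The state of the evaluation at `x` of `nceSet l` over the stage `s` approximations. -/
def nceState (s x : ℕ) (l : List ℕ) : Bool × Bool × Bool :=
  l.foldr (fun e r => nceStep (ceStage s e x) r) (false, false, false)

/-- The stage `s` approximation of the set `nceSet l`. -/
def nceStage (s x : ℕ) (l : List ℕ) : Bool :=
  (nceState s x l).1

/-- `nceSet` consumes two entries at a time; carrying three bits turns it into an ordinary fold,
whose step is primitive recursive because its domain is finite. -/
theorem Primrec.nceStage {α : Type*} [Primcodable α] {s x : α → ℕ} {l : α → List ℕ}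
    (hs : Primrec s) (hx : Primrec x) (hl : Primrec l) :
    Primrec fun a => nceStage (s a) (x a) (l a) := by
  have hstep : Primrec fun p : Bool × (Bool × Bool × Bool) => nceStep p.1 p.2 :=
    Primrec.dom_finite _
  have hh : Primrec₂ fun (a : α) (p : ℕ × (Bool × Bool × Bool)) =>
      nceStep (_root_.ceStage (s a) p.1 (x a)) p.2 :=
    hstep.comp <| (Primrec.ceStage (hs.comp Primrec.fst) (Primrec.fst.comp Primrec.snd)
      (hx.comp Primrec.fst)).pair (Primrec.snd.comp Primrec.snd)
  exact Primrec.fst.comp (Primrec.list_foldr hl (Primrec.const (false, false, false)) hh)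

theorem Computable.nceStage {α : Type*} [Primcodable α] {s x : α → ℕ} {l : α → List ℕ}
    (hs : Computable s) (hx : Computable x) (hl : Computable l) :
    Computable fun a => nceStage (s a) (x a) (l a) :=
  (Primrec.nceStage (Primrec.fst.comp Primrec.fst) (Primrec.snd.comp Primrec.fst)
    Primrec.snd).to_comp.comp ((hs.pair hx).pair hl)

theorem eventually_nceStage (x : ℕ) (l : List ℕ) :
    ∀ᶠ s in atTop, (nceStage s x l = true ↔ x ∈ nceSet l) := by
  induction l using nceSet.induct with
  | case1 => simp [nceStage, nceState, nceSet]
  | case2 e =>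
    filter_upwards [eventually_ceStage e x] with s hs
    simpa [nceStage, nceState, nceStep, nceSet] using hs
  | case3 e e' l ih =>
    filter_upwards [ih, eventually_ceStage e x, eventually_ceStage e' x] with s hl he he'
    rw [nceSet, Set.mem_union, Set.mem_sdiff, ← hl, ← he, ← he']
    simp [nceStage, nceState, nceStep]

-- Quantifier normal forms and the `Π⁰₂` bound

/-- Two convergent approximations have equivalent limits iff they agree infinitely often. -/
theorem iff_iff_forall_exists_eq {u v : ℕ → Bool} {P Q : Prop}
    (hu : ∀ᶠ s in atTop, (u s = true ↔ P)) (hv : ∀ᶠ s in atTop, (v s = true ↔ Q)) :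
    (P ↔ Q) ↔ ∀ s, ∃ t, u (s + t) = v (s + t) := by
  obtain ⟨N, hN⟩ := eventually_atTop.1 (hu.and hv)
  constructor
  · intro h s
    refine ⟨N, ?_⟩
    obtain ⟨h₁, h₂⟩ := hN (s + N) (Nat.le_add_left _ _)
    rw [Bool.eq_iff_iff, h₁, h₂, h]
  · intro h
    obtain ⟨t, ht⟩ := h N
    obtain ⟨h₁, h₂⟩ := hN (N + t) (Nat.le_add_right _ _)
    rw [← h₁, ← h₂, ht]

theorem Computable.computablePred_eq_true {α : Type*} [Primcodable α] {g : α → Bool}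
    (hg : Computable g) : ComputablePred fun a => g a = true :=
  ⟨inferInstance, by simpa using hg⟩

theorem Computable.beq_bool {α : Type*} [Primcodable α] {f g : α → Bool}
    (hf : Computable f) (hg : Computable g) : Computable fun a => f a == g a :=
  (Primrec.dom_finite fun p : Bool × Bool => p.1 == p.2).to_comp.comp (hf.pair hg)

theorem isPi0_two_of_computable {α : Type} [Primcodable α] {p : α → Prop}
    {g : (α × ℕ) × ℕ → Bool} (hg : Computable g)
    (hp : ∀ a, p a ↔ ∀ y, ∃ z, g ((a, y), z) = true) : IsPi0 2 p :=
  ⟨_, ⟨_, hg.computablePred_eq_true, fun _ => Iff.rfl⟩, hp⟩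

theorem isPi0_four_of_computable {α : Type} [Primcodable α] {p : α → Prop}
    {g : (((α × ℕ) × ℕ) × ℕ) × ℕ → Bool} (hg : Computable g)
    (hp : ∀ a, p a ↔ ∀ n, ∃ k, ∀ y, ∃ z, g ((((a, n), k), y), z) = true) : IsPi0 4 p :=
  ⟨_, ⟨_, ⟨_, ⟨_, hg.computablePred_eq_true, fun _ => Iff.rfl⟩, fun _ => Iff.rfl⟩,
    fun _ => Iff.rfl⟩, hp⟩

theorem IsPi0.exists_computable_two {α : Type} [Primcodable α] {p : α → Prop} (hp : IsPi0 2 p) :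
    ∃ g : (α × ℕ) × ℕ → Bool, Computable g ∧ ∀ a, p a ↔ ∀ y, ∃ z, g ((a, y), z) = true := by
  obtain ⟨q, ⟨r, ⟨_, hr⟩, hqr⟩, hpq⟩ := hp
  exact ⟨_, hr, fun a => by simp only [hpq, hqr, decide_eq_true_eq]⟩

theorem IsPi0.exists_computable_four {α : Type} [Primcodable α] {p : α → Prop} (hp : IsPi0 4 p) :
    ∃ g : (((α × ℕ) × ℕ) × ℕ) × ℕ → Bool, Computable g ∧
      ∀ a, p a ↔ ∀ n, ∃ k, ∀ y, ∃ z, g ((((a, n), k), y), z) = true := by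
  obtain ⟨q, ⟨r, ⟨s, ⟨t, ⟨_, ht⟩, hst⟩, hrs⟩, hqr⟩, hpq⟩ := hp
  exact ⟨_, ht, fun a => by simp only [hpq, hqr, hrs, hst, decide_eq_true_eq]⟩

theorem isPi0_two_eqNce {h : ℕ → List ℕ} (hcomp : Computable h) :
    IsPi0 2 fun p : ℕ × ℕ => EqNce h p.1 p.2 := by
  have hstage {f : ((ℕ × ℕ) × ℕ) × ℕ → ℕ} (hf : Computable f) :
      Computable fun a : ((ℕ × ℕ) × ℕ) × ℕ =>
        nceStage (a.1.2.unpair.2 + a.2) a.1.2.unpair.1 (h (f a)) := by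
    have hu : Primrec fun a : ((ℕ × ℕ) × ℕ) × ℕ => a.1.2.unpair :=
      Primrec.unpair.comp (Primrec.snd.comp Primrec.fst)
    exact Computable.nceStage
      (Primrec.nat_add.comp (Primrec.snd.comp hu) Primrec.snd).to_comp
      (Primrec.fst.comp hu).to_comp (hcomp.comp hf)
  have hp : Primrec fun a : ((ℕ × ℕ) × ℕ) × ℕ => a.1.1 := Primrec.fst.comp Primrec.fst
  refine isPi0_two_of_computable ((hstage (Primrec.fst.comp hp).to_comp).beq_bool
    (hstage (Primrec.snd.comp hp).to_comp)) ?_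
  rintro ⟨i, j⟩
  simp only [EqNce, Set.ext_iff, beq_iff_eq,
    iff_iff_forall_exists_eq (eventually_nceStage _ (h i)) (eventually_nceStage _ (h j))]
  -- The point `x` and the stage `s` share one universal quantifier through pairing.
  exact ⟨fun H y => H _ _, fun H x s => by simpa using H (Nat.pair x s)⟩

-- Reduction to `E3ce`

theorem computablyReducible_eqNce_E3ce {h : ℕ → List ℕ} (hcomp : Computable h) :
    ComputablyReducible (EqNce h) E3ce := by
  -- The column of `x` collects the numbers below some stage at which `x` appears to be in the set.
  have hg : Computable fun a : (ℕ × ℕ) × ℕ =>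
      nceStage (a.1.2.unpair.2 + a.2) a.1.2.unpair.1 (h a.1.1) := by
    have hu : Primrec fun a : (ℕ × ℕ) × ℕ => a.1.2.unpair :=
      Primrec.unpair.comp (Primrec.snd.comp Primrec.fst)
    exact Computable.nceStage
      (Primrec.nat_add.comp (Primrec.snd.comp hu) Primrec.snd).to_comp
      (Primrec.fst.comp hu).to_comp (hcomp.comp (Computable.fst.comp Computable.fst))
  obtain ⟨f, hf, hfx⟩ := (REPred.exists_computable hg).exists_index
  have hcol (i x) : column (ceSet (f i)) x = {m | ∃ t, nceStage (m + t) x (h i) = true} := by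
    ext m
    simp [column, hfx]
  have huniv {i x} (hx : x ∈ nceSet (h i)) : column (ceSet (f i)) x = Set.univ := by
    obtain ⟨N, hN⟩ := eventually_atTop.1 (eventually_nceStage x (h i))
    rw [hcol, Set.eq_univ_iff_forall]
    exact fun m => ⟨N, (hN _ (Nat.le_add_left _ _)).2 hx⟩
  have hfin {i x} (hx : x ∉ nceSet (h i)) : (column (ceSet (f i)) x).Finite := by
    obtain ⟨N, hN⟩ := eventually_atTop.1 (eventually_nceStage x (h i))
    rw [hcol]
    refine (Set.finite_lt_nat N).subset fun m ⟨t, ht⟩ => ?_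
    by_contra hm
    exact hx ((hN _ (by simp at hm; omega)).1 ht)
  have hinf {A : Set ℕ} (hA : A.Finite) : ¬ (symmDiff A Set.univ).Finite := by
    rw [← Set.top_eq_univ, symmDiff_top]
    exact hA.infinite_compl
  refine ⟨f, hf, fun i j => ?_⟩
  simp only [EqNce, Set.ext_iff, E3ce, E3, E0]
  refine forall_congr' fun x => ?_
  by_cases hi : x ∈ nceSet (h i) <;> by_cases hj : x ∈ nceSet (h j)
  · simp [hi, hj, huniv]
  · simp only [hi, hj, huniv hi]
    rw [symmDiff_comm]
    simpa using hinf (hfin hj)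
  · simp only [hi, hj, huniv hj]
    simpa using hinf (hfin hi)
  · simp only [hi, hj, true_iff]
    exact ((hfin hi).union (hfin hj)).subset symmDiff_le_sup

-- The `Π⁰₄` bound for `E3ce`

/-- The inner equivalence of c.e. memberships is `∀∃`, so its `∀` merges with `∀ m` and `E0` costs
only `∃∀∃`. -/
theorem E0_iff_exists_forall {A B : Set ℕ} : E0 A B ↔ ∃ N, ∀ m, (N + m ∈ A ↔ N + m ∈ B) := by
  rw [E0, Set.finite_iff_bddAbove]
  constructor
  · rintro ⟨N, hN⟩
    refine ⟨N + 1, fun m => ?_⟩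
    by_contra hm
    have := hN (a := N + 1 + m) (by rw [Set.mem_symmDiff]; tauto)
    omega
  · rintro ⟨N, hN⟩
    refine ⟨N, fun m hm => ?_⟩
    by_contra hlt
    have := hN (m - N)
    rw [Nat.add_sub_cancel' (by omega)] at this
    rw [Set.mem_symmDiff] at hm
    tauto

theorem isPi0_four_E3ce : IsPi0 4 fun p : ℕ × ℕ => E3ce p.1 p.2 := by
  have hstage {f : ((((ℕ × ℕ) × ℕ) × ℕ) × ℕ) × ℕ → ℕ} (hf : Primrec f) :
      Computable fun a : ((((ℕ × ℕ) × ℕ) × ℕ) × ℕ) × ℕ =>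
        ceStage (a.1.2.unpair.2 + a.2) (f a)
          (Nat.pair a.1.1.1.2 (a.1.1.2 + a.1.2.unpair.1)) := by
    have hu : Primrec fun a : ((((ℕ × ℕ) × ℕ) × ℕ) × ℕ) × ℕ => a.1.2.unpair :=
      Primrec.unpair.comp (Primrec.snd.comp Primrec.fst)
    exact (Primrec.ceStage (Primrec.nat_add.comp (Primrec.snd.comp hu) Primrec.snd) hf
      (Primrec₂.natPair.comp
        (Primrec.snd.comp (Primrec.fst.comp (Primrec.fst.comp Primrec.fst)))
        (Primrec.nat_add.comp (Primrec.snd.comp (Primrec.fst.comp Primrec.fst))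
          (Primrec.fst.comp hu)))).to_comp
  have hp : Primrec fun a : ((((ℕ × ℕ) × ℕ) × ℕ) × ℕ) × ℕ => a.1.1.1.1 :=
    Primrec.fst.comp (Primrec.fst.comp (Primrec.fst.comp Primrec.fst))
  refine isPi0_four_of_computable
    ((hstage (Primrec.fst.comp hp)).beq_bool (hstage (Primrec.snd.comp hp))) ?_
  rintro ⟨i, j⟩
  simp only [E3ce, E3, E0_iff_exists_forall, column, Set.mem_ofPred_eq, beq_iff_eq,
    iff_iff_forall_exists_eq (eventually_ceStage i _) (eventually_ceStage j _)]
  refine forall_congr' fun n => exists_congr fun N => ?_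
  exact ⟨fun H y => H _ _, fun H x s => by simpa using H (Nat.pair x s)⟩

-- Deficiency sets and `Π⁰₄`-hardness

/-- The Dekker deficiency set of a sequence `e` is cofinite iff `e` takes some value infinitely
often. -/
theorem finite_compl_deficiency_iff (e : ℕ → ℕ) :
    {s | ∃ t, e (s + t + 1) ≤ e s}ᶜ.Finite ↔ ∃ k, ∃ᶠ s in atTop, e s = k := by
  constructor
  · intro hfin
    by_contra! hk
    have htop : Tendsto e atTop atTop := by
      rw [← Nat.cofinite_eq_atTop]
      refine Tendsto.cofinite_of_finite_preimage_singleton fun k => ?_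
      have := hk k
      rw [← Nat.cofinite_eq_atTop, eventually_cofinite] at this
      exact (by simpa using this : {s | e s = k}.Finite)
    obtain ⟨N, hN⟩ := hfin.bddAbove
    -- The last place where the minimum of `e` beyond `N` is attained is not deficient.
    obtain ⟨v, ⟨s₀, hs₀, rfl⟩, hmin⟩ : ∃ v, (∃ s, N < s ∧ e s = v) ∧ ∀ s, N < s → v ≤ e s := by
      have hex : ∃ v s, N < s ∧ e s = v := ⟨_, N + 1, Nat.lt_succ_self N, rfl⟩
      classical
      exact ⟨Nat.find hex, Nat.find_spec hex, fun s hs => Nat.find_min' hex ⟨s, hs, rfl⟩⟩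
    obtain ⟨M, hM⟩ := eventually_atTop.1 (htop.eventually_gt_atTop (e s₀))
    have hP : e (Nat.findGreatest (fun s => N < s ∧ e s = e s₀) M) = e s₀ ∧
        N < Nat.findGreatest (fun s => N < s ∧ e s = e s₀) M := by
      have hs₀M : s₀ ≤ M := by
        by_contra hlt
        exact lt_irrefl _ (hM s₀ (by omega))
      exact (Nat.findGreatest_spec (P := fun s => N < s ∧ e s = e s₀) hs₀M ⟨hs₀, rfl⟩).symm
    set s := Nat.findGreatest (fun s => N < s ∧ e s = e s₀) M with hs
    refine absurd (hN (a := s) ?_) (by omega)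
    rintro ⟨t, ht⟩
    have heq : e (s + t + 1) = e s₀ := le_antisymm (ht.trans_eq hP.1) (hmin _ (by omega))
    have hle : s + t + 1 ≤ M := by
      by_contra hlt
      exact (hM (s + t + 1) (by omega)).ne' heq
    have := Nat.le_findGreatest (P := fun s => N < s ∧ e s = e s₀) hle ⟨by omega, heq⟩
    omega
  · rintro ⟨k, hk⟩
    classical
    -- Take the least value repeated infinitely often: almost every term is at least that value, and
    -- it recurs after each such term, making the term deficient.
    have hex : ∃ k, ∃ᶠ s in atTop, e s = k := ⟨k, hk⟩
    have hle : ∀ᶠ s in atTop, Nat.find hex ≤ e s := by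
      have : ∀ᶠ s in atTop, ∀ j ∈ Finset.range (Nat.find hex), e s ≠ j := by
        rw [Finset.eventually_all]
        exact fun j hj => not_frequently.1 (Nat.find_min hex (Finset.mem_range.1 hj))
      filter_upwards [this] with s hs
      by_contra! hlt
      exact hs _ (Finset.mem_range.2 hlt) rfl
    have hfin : {s | ¬ Nat.find hex ≤ e s}.Finite := by
      rwa [← eventually_cofinite, Nat.cofinite_eq_atTop]
    refine hfin.subset fun s hs hes => hs ?_
    obtain ⟨t, ht, hte⟩ := frequently_atTop.1 (Nat.find_spec hex) (s + 1)
    exact ⟨t - (s + 1), by rwa [show s + (t - (s + 1)) + 1 = t by omega, hte]⟩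

/-- The bound `w + 1` is the first at which all of `0, …, a` have appeared in `W_e`. -/
def appearsAt (e a w : ℕ) : Prop :=
  (∀ b < a + 1, ceStage (w + 1) e b = true) ∧ ¬ ∀ b < a + 1, ceStage w e b = true

instance (e a w : ℕ) : Decidable (appearsAt e a w) :=
  inferInstanceAs (Decidable (_ ∧ ¬ _))

theorem primrecPred_appearsAt {α : Type*} [Primcodable α] {e a w : α → ℕ} (he : Primrec e)
    (ha : Primrec a) (hw : Primrec w) : PrimrecPred fun i => appearsAt (e i) (a i) (w i) := by
  have hR : PrimrecRel fun (b : ℕ) (p : ℕ × ℕ) => ceStage p.2 p.1 b = true :=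
    ⟨inferInstance, by
      simpa using Primrec.ceStage (Primrec.snd.comp Primrec.snd) (Primrec.fst.comp Primrec.snd)
        Primrec.fst⟩
  have ha' := Primrec.succ.comp ha
  have hall : PrimrecRel fun (n : ℕ) (p : ℕ × ℕ) => ∀ b < n, ceStage p.2 p.1 b = true :=
    (hR.forall_mem_list.comp (Primrec.list_range.comp Primrec.fst) Primrec.snd).of_eq (by simp)
  have h₁ : PrimrecPred fun i => ∀ b < a i + 1, ceStage (w i + 1) (e i) b = true :=
    hall.comp ha' (he.pair (Primrec.succ.comp hw))
  have h₂ : PrimrecPred fun i => ∀ b < a i + 1, ceStage (w i) (e i) b = true :=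
    hall.comp ha' (he.pair hw)
  exact h₁.and h₂.not

theorem appearsAt_unique {e a w w' : ℕ} (h : appearsAt e a w) (h' : appearsAt e a w') :
    w = w' := by
  have key {w w' : ℕ} (h : appearsAt e a w) (h' : appearsAt e a w') : w' ≤ w := by
    by_contra! hlt
    exact h'.2 fun b hb => ceStage_mono hlt (h.1 b hb)
  exact le_antisymm (key h' h) (key h h')

theorem exists_appearsAt_iff {e a : ℕ} :
    (∃ w, appearsAt e a w) ↔ ∀ b < a + 1, b ∈ ceSet e := by
  constructor
  · rintro ⟨w, hw, -⟩ b hb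
    exact mem_ceSet_iff.2 ⟨_, hw b hb⟩
  · intro hmem
    have hev : ∃ w, ∀ b < a + 1, ceStage w e b = true := by
      have : ∀ᶠ w in atTop, ∀ b ∈ Finset.range (a + 1), ceStage w e b = true := by
        rw [Finset.eventually_all]
        intro b hb
        filter_upwards [eventually_ceStage e b] with w hw
        exact hw.2 (hmem b (Finset.mem_range.1 hb))
      obtain ⟨w, hw⟩ := this.exists
      exact ⟨w, fun b hb => hw b (Finset.mem_range.2 hb)⟩
    classical
    -- `evaln` with bound 0 returns nothing, so the least bound is positive, hence of the form `w +
    -- 1`.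
    rcases hfind : Nat.find hev with _ | w
    · have := Nat.find_spec hev 0 (Nat.succ_pos a)
      rw [hfind] at this
      simp [ceStage, Nat.Partrec.Code.evaln] at this
    · exact ⟨w, hfind ▸ Nat.find_spec hev, Nat.find_min hev (by omega)⟩

/-- The value at `s = ⟨k, ⟨a, w⟩⟩` is `k` if `w` is the bound at which `0, …, a` have appeared in
`W_e`, and `s` otherwise. -/
def markerValue (e s : ℕ) : ℕ :=
  if appearsAt e s.unpair.2.unpair.1 s.unpair.2.unpair.2 then s.unpair.1 else s

theorem primrec_markerValue : Primrec₂ markerValue := by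
  have hs : Primrec fun p : ℕ × ℕ => p.2.unpair := Primrec.unpair.comp Primrec.snd
  have hs' : Primrec fun p : ℕ × ℕ => p.2.unpair.2.unpair :=
    Primrec.unpair.comp (Primrec.snd.comp hs)
  exact Primrec.ite (primrecPred_appearsAt Primrec.fst (Primrec.fst.comp hs')
    (Primrec.snd.comp hs')) (Primrec.fst.comp hs) Primrec.snd

/-- Each `a` contributes at most one `s = ⟨k, ⟨a, w⟩⟩`, and does so iff `0, …, a` all lie in the
set; a missing `b` leaves only `a < b`. The default value `s` equals `k` only at `s = k`. -/
theorem frequently_markerValue_iff (d : ℕ → ℕ) (k : ℕ) :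
    (∃ᶠ s in atTop, markerValue (d s.unpair.1) s = k) ↔ ∀ b, b ∈ ceSet (d k) := by
  rw [Nat.frequently_atTop_iff_infinite]
  constructor
  · intro hinf b
    by_contra hb
    refine hinf (((Set.finite_singleton k).union ((Set.finite_lt_nat b).biUnion fun a _ =>
      (Set.Subsingleton.finite (s := {w | appearsAt (d k) a w})
        fun w hw w' hw' => appearsAt_unique hw hw').image
          fun w => Nat.pair k (Nat.pair a w))).subset ?_)
    intro s hs
    simp only [Set.mem_ofPred_eq, markerValue] at hs
    split_ifs at hs with happ
    · subst hs
      refine Or.inr (Set.mem_biUnion (x := s.unpair.2.unpair.1) ?_ ⟨s.unpair.2.unpair.2, happ, ?_⟩)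
      · by_contra hlt
        simp only [Set.mem_ofPred_eq, not_lt] at hlt
        exact hb (exists_appearsAt_iff.1 ⟨_, happ⟩ b (by omega))
      · simp
    · exact Or.inl hs
  · intro hall
    choose w hw using fun a => exists_appearsAt_iff.2 fun b (_ : b < a + 1) => hall b
    refine (Set.infinite_range_of_injective (f := fun a => Nat.pair k (Nat.pair a (w a)))
      fun a a' haa => ?_).mono ?_
    · simp only [Nat.pair_eq_pair] at haa
      exact haa.2.1
    · rintro _ ⟨a, rfl⟩
      simp [markerValue, hw]

theorem exists_ceSet_eq_univ : ∃ u, ceSet u = Set.univ := by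
  obtain ⟨f, -, hf⟩ := (REPred.exists_computable (α := ℕ × ℕ)
    (Computable.const true)).exists_index
  exact ⟨f 0, Set.eq_univ_of_forall fun x => (hf 0 x).2 ⟨0, rfl⟩⟩

/-- The deficiency sets of a uniformly computable double sequence of sequences are the columns of
a uniformly computably enumerable sequence of sets. -/
theorem exists_index_column_deficiency {m : ℕ × ℕ → ℕ → ℕ} (hm : Computable₂ m) :
    ∃ f : ℕ → ℕ, Computable f ∧ ∀ x n,
      column (ceSet (f x)) n = {s | ∃ t, m (x, n) (s + t + 1) ≤ m (x, n) s} := by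
  have hdef : Computable fun p : (ℕ × ℕ) × ℕ =>
      decide (m (p.1.1, p.1.2.unpair.1) (p.1.2.unpair.2 + p.2 + 1) ≤
        m (p.1.1, p.1.2.unpair.1) p.1.2.unpair.2) := by
    have hu : Primrec fun p : (ℕ × ℕ) × ℕ => p.1.2.unpair :=
      Primrec.unpair.comp (Primrec.snd.comp Primrec.fst)
    have hx : Primrec fun p : (ℕ × ℕ) × ℕ => (p.1.1, p.1.2.unpair.1) :=
      (Primrec.fst.comp Primrec.fst).pair (Primrec.fst.comp hu)
    have hs := Primrec.snd.comp hu
    have ht : Primrec fun p : (ℕ × ℕ) × ℕ => p.1.2.unpair.2 + p.2 + 1 :=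
      Primrec.succ.comp (Primrec.nat_add.comp hs Primrec.snd)
    have hle : Computable₂ fun a b : ℕ => decide (a ≤ b) := Primrec.nat_le.decide.to_comp
    exact hle.comp (hm.comp hx.to_comp ht.to_comp) (hm.comp hx.to_comp hs.to_comp)
  obtain ⟨f, hf, hfx⟩ := (REPred.exists_computable hdef).exists_index
  refine ⟨f, hf, fun x n => ?_⟩
  ext s
  simp [column, hfx]

/-- Here `d ((x, n), k)` indexes the set of `y` with a witness `z`, so the matrix `∀ y, ∃ z` says
that this set is `ℕ`. -/
theorem manyOneReducible_E3ce {q : ℕ → Prop} (hq : IsPi0 4 q) :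
    q ≤₀ fun p : ℕ × ℕ => E3ce p.1 p.2 := by
  obtain ⟨g, hg, hqg⟩ := hq.exists_computable_four
  obtain ⟨d, hd, hdg⟩ := (REPred.exists_computable hg).exists_index
  have hm : Computable₂ fun (p : ℕ × ℕ) (s : ℕ) => markerValue (d (p, s.unpair.1)) s :=
    primrec_markerValue.to_comp.comp (hd.comp (Computable.fst.pair
      (Primrec.fst.comp (Primrec.unpair.comp Primrec.snd)).to_comp)) Computable.snd
  obtain ⟨f, hf, hfx⟩ := exists_index_column_deficiency hm
  obtain ⟨u, hu⟩ := exists_ceSet_eq_univ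
  refine ⟨fun x => (f x, u), hf.pair (Computable.const u), fun x => ?_⟩
  rw [hqg]
  refine forall_congr' fun n => ?_
  have huniv : column (ceSet u) n = ⊤ := by
    simp [column, hu]
  rw [hfx, huniv, E0, symmDiff_top]
  refine Iff.trans ?_ (finite_compl_deficiency_iff
    fun s => markerValue (d ((x, n), s.unpair.1)) s).symm
  refine exists_congr fun k => ?_
  rw [frequently_markerValue_iff fun k => d ((x, n), k)]
  exact forall_congr' fun y => (hdg _ _).symm

theorem isPi0Complete_four_E3ce : IsPi0Complete 4 fun p : ℕ × ℕ => E3ce p.1 p.2 :=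
  ⟨isPi0_four_E3ce, fun _ => manyOneReducible_E3ce⟩

-- Diagonalization and non-reducibility

/-- The set of `e` with some `⟨e, y⟩ ∉ W_e` is `Σ⁰₂`, hence `Π⁰₄` with dummy outer and inner
quantifiers. A `Π⁰₂` form would give a c.e. set of pairs whose own index contradicts it. -/
theorem exists_isPi0_four_not_isPi0_two : ∃ p : ℕ → Prop, IsPi0 4 p ∧ ¬ IsPi0 2 p := by
  refine ⟨fun e => ∃ y, ∀ z, (!ceStage z e (Nat.pair e y)) = true, ?_, ?_⟩
  · have he : Primrec fun a : (((ℕ × ℕ) × ℕ) × ℕ) × ℕ => a.1.1.1.1 :=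
      Primrec.fst.comp (Primrec.fst.comp (Primrec.fst.comp Primrec.fst))
    refine isPi0_four_of_computable (Primrec.not.comp (Primrec.ceStage
      (Primrec.snd.comp Primrec.fst) he (Primrec₂.natPair.comp he
        (Primrec.snd.comp (Primrec.fst.comp Primrec.fst))))).to_comp fun e => ?_
    simp
  · intro h
    obtain ⟨g, hg, hpg⟩ := h.exists_computable_two
    have hg' : Computable fun a : (ℕ × ℕ) × ℕ => g (a.1.2.unpair, a.2) :=
      hg.comp (((Primrec.unpair.comp (Primrec.snd.comp Primrec.fst)).pair Primrec.snd).to_comp)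
    -- The parameter is a dummy: `f 0` indexes the single set of pairs `⟨e, y⟩` having a witness
    -- `z`.
    obtain ⟨f, -, hf⟩ := (REPred.exists_computable hg').exists_index
    have hd := hpg (f 0)
    have hmem (y) : (∃ z, g ((f 0, y), z) = true) ↔ Nat.pair (f 0) y ∈ ceSet (f 0) := by
      rw [hf]
      simp
    simp only [hmem, mem_ceSet_iff] at hd
    by_cases hall : ∀ y, ∃ s, ceStage s (f 0) (Nat.pair (f 0) y) = true
    · obtain ⟨y, hy⟩ := hd.2 hall
      obtain ⟨s, hs⟩ := hall y
      simpa [hs] using hy s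
    · refine hall (hd.1 ?_)
      simpa using hall

theorem IsPi0.two_of_manyOneReducible {α β : Type} [Primcodable α] [Primcodable β] {p : α → Prop}
    {q : β → Prop} (hpq : p ≤₀ q) (hq : IsPi0 2 q) : IsPi0 2 p := by
  obtain ⟨f, hf, hfp⟩ := hpq
  obtain ⟨g, hg, hqg⟩ := hq.exists_computable_two
  refine isPi0_two_of_computable (g := fun a => g ((f a.1.1, a.1.2), a.2))
    (hg.comp (((hf.comp (Computable.fst.comp Computable.fst)).pair
      (Computable.snd.comp Computable.fst)).pair Computable.snd)) fun a => ?_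
  rw [hfp, hqg]

theorem not_computablyReducible_E3ce {F : ℕ → ℕ → Prop}
    (hF : IsPi0 2 fun p : ℕ × ℕ => F p.1 p.2) : ¬ ComputablyReducible E3ce F := by
  rintro ⟨f, hf, hfE⟩
  obtain ⟨p, hp, hp'⟩ := exists_isPi0_four_not_isPi0_two
  have hred : (fun p : ℕ × ℕ => E3ce p.1 p.2) ≤₀ fun p : ℕ × ℕ => F p.1 p.2 :=
    ⟨fun p => (f p.1, f p.2), (hf.comp Computable.fst).pair (hf.comp Computable.snd),
      fun p => hfE p.1 p.2⟩
  exact hp' (IsPi0.two_of_manyOneReducible ((manyOneReducible_E3ce hp).trans hred) hF)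

theorem mainTheorem12 (h : ℕ → List ℕ) (hcomp : Computable h) (hbij : Function.Bijective h) :
    ComputablyReducible (EqNce h) E3ce ∧
      ¬ ComputablyReducible E3ce (EqNce h) ∧
      IsPi0 2 (fun p : ℕ × ℕ => EqNce h p.1 p.2) ∧
      IsPi0Complete 4 (fun p : ℕ × ℕ => E3ce p.1 p.2) :=
  ⟨computablyReducible_eqNce_E3ce hcomp, not_computablyReducible_E3ce (isPi0_two_eqNce hcomp),
    isPi0_two_eqNce hcomp, isPi0Complete_four_E3ce⟩
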